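/- Fix a finite non-empty set $V$ of state variables ranging over $\mathbb Z$; for $v\in V$ and $j\ge 0$ write $v^{(j)}$ for $v$ decorated with $j$ primes. A monotonicity constraint (MC) over $\mathbb Z$ is an expression $p\odot q$, where each of $p,q$ is an integer constant or some $v^{(j)}$ and $\odot\in\{=,\neq,\le,<\}$. An $\mathrm{MC}_{\mathbb Z}$ property is given by the grammar $\psi ::= c \mid \psi\wedge\psi \mid \neg\psi \mid \mathsf X_s\psi \mid \psi\,\mathsf U\,\psi$ with $c$ an MC over $\mathbb Z$. A trace is a non-empty finite sequence $\tau=\alpha_0,\dots,\alpha_{n-1}$ of assignments $\alpha_i: V\to\mathbb Z$. Satisfaction at an instant $i \geq 0$ is defined as follows. For an MC, $\tau,i\models p\odot q$ iff $i<n$ and either some $v^{(j)}$ occurring in $p\odot q$ has $i+j\ge n$, or $p\odot q$ holds when each $v^{(j)}$ is given the value $\alpha_{i+j}(v)$. Conjunction and negation are interpreted as usual; $\tau,i\models\mathsf X_s\psi$ iff $i+1<n$ and $\tau,i+1\models\psi$; and $\tau,i\models\psi_1\,\mathsf U\,\psi_2$ iff there is $j$ with $i\le j<n$, $\tau,j\models\psi_2$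 and $\tau,l\models\psi_1$ for all $i\le l<j$. Write $\tau\models\psi$ for $\tau,0\models\psi$. After a trace $\tau$, the monitoring state of $\psi$ is: $\mathrm{CS}$ if $\tau\models\psi$ and $\tau\tau'\not\models\psi$ for some trace $\tau'$; $\mathrm{PS}$ if $\tau\models\psi$ and $\tau\tau'\models\psi$ for every trace $\tau'$; $\mathrm{CV}$ if $\tau\not\models\psi$ and $\tau\tau'\models\psi$ for some trace $\tau'$; $\mathrm{PV}$ if $\tau\not\models\psi$ and $\tau\tau'\not\models\psi$ for every trace $\tau'$. **Theorem.** Monitoring is solvable for $\mathrm{MC}_{\mathbb Z}$ properties: there is an algorithm (a total computable function) that, given any finite non-empty variable set, any $\mathrm{MC}_{\mathbb Z}$ property $\psi$ and any trace $\tau$ over it, returns the monitoring state of $\psi$ after $\tau$. -/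

import Mathlib

namespace ALTLf

/-- The comparison operators of monotonicity constraints. -/
inductive Rel where
  | eq | ne | le | lt

/-- The meaning of a comparison operator over the integers. -/
def Rel.holds : Rel → ℤ → ℤ → Prop
  | .eq, a, b => a = b
  | .ne, a, b => a ≠ b
  | .le, a, b => a ≤ b
  | .lt, a, b => a < b

/-- The sides of a monotonicity constraint over `ℤ` and the `k` state variables `Fin k`:
an integer constant, or a state variable `v` decorated with `j` primes (lookahead `j`). -/
inductive Term (k : ℕ) where
  | const (d : ℤ)
  | var (v : Fin k) (j : ℕ)

/-- A monotonicity constraint `p ⊙ q` over `ℤ`. -/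
structure MC (k : ℕ) where
  rel : Rel
  lhs : Term k
  rhs : Term k

/-- Properties whose atoms are monotonicity constraints over `ℤ`. -/
inductive Property (k : ℕ) where
  | atom (c : MC k)
  | and (ψ₁ ψ₂ : Property k)
  | not (ψ : Property k)
  | next (ψ : Property k)
  | untl (ψ₁ ψ₂ : Property k)

/-- An assignment of integers to the state variables. -/
abbrev Assignment (k : ℕ) : Type := Fin k → ℤ

/-- A trace is a nonempty finite sequence of assignments. -/
abbrev Trace (k : ℕ) : Type := {l : List (Assignment k) // l ≠ []}

/-- The concatenation `ττ'` of two traces. -/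
def Trace.append {k : ℕ} (τ τ' : Trace k) : Trace k :=
  ⟨τ.1 ++ τ'.1, List.append_ne_nil_of_left_ne_nil τ.2 τ'.1⟩

/-- The number of assignments in a trace. -/
def Trace.length {k : ℕ} (τ : Trace k) : ℕ := τ.1.length

/-- No variable of the term points beyond the end of the trace. -/
def Term.WellDefined {k : ℕ} (τ : Trace k) (i : ℕ) : Term k → Prop
  | .const _ => True
  | .var _ j => i + j < τ.length

/-- The value of a term at instant `i`; it is only used where the term is well-defined, so the
default `0` never plays a role. -/
def Term.eval {k : ℕ} (τ : Trace k) (i : ℕ) : Term k → ℤ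
  | .const d => d
  | .var v j => τ.1.getD (i + j) 0 v

/-- Satisfaction of an atom at instant `i`: weak semantics for variables with lookahead. -/
def MC.Sat {k : ℕ} (τ : Trace k) (i : ℕ) (c : MC k) : Prop :=
  i < τ.length ∧
    (¬ (c.lhs.WellDefined τ i ∧ c.rhs.WellDefined τ i) ∨
      c.rel.holds (c.lhs.eval τ i) (c.rhs.eval τ i))

/-- Satisfaction `τ, i ⊨ ψ`. -/
def Property.SatAt {k : ℕ} (τ : Trace k) : Property k → ℕ → Prop
  | .atom c, i => c.Sat τ i
  | .and ψ₁ ψ₂, i => ψ₁.SatAt τ i ∧ ψ₂.SatAt τ i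
  | .not ψ, i => ¬ ψ.SatAt τ i
  | .next ψ, i => i + 1 < τ.length ∧ ψ.SatAt τ (i + 1)
  | .untl ψ₁ ψ₂, i =>
      ∃ j, i ≤ j ∧ j < τ.length ∧ ψ₂.SatAt τ j ∧ ∀ l, i ≤ l → l < j → ψ₁.SatAt τ l

/-- The clause for until agrees with its usual unfolding. -/
theorem Property.satAt_until_iff {k : ℕ} (τ : Trace k) (ψ₁ ψ₂ : Property k) (i : ℕ) :
    (Property.untl ψ₁ ψ₂).SatAt τ i ↔
      i < τ.length ∧ (ψ₂.SatAt τ i ∨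
        (i + 1 < τ.length ∧ ψ₁.SatAt τ i ∧ (Property.untl ψ₁ ψ₂).SatAt τ (i + 1))) := by
  simp only [Property.SatAt]
  constructor
  · rintro ⟨j, hij, hj, h2, h1⟩
    refine ⟨by omega, ?_⟩
    rcases Nat.eq_or_lt_of_le hij with rfl | hlt
    · exact Or.inl h2
    · exact Or.inr ⟨by omega, h1 i le_rfl hlt, j, hlt, hj, h2,
        fun l hl hlj => h1 l (by omega) hlj⟩
  · rintro ⟨hi, h2 | ⟨_, h1, j, hij, hj, h2, h1'⟩⟩
    · exact ⟨i, le_rfl, hi, h2, fun l hl hli => absurd hli (by omega)⟩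
    · refine ⟨j, by omega, hj, h2, fun l hl hlj => ?_⟩
      rcases Nat.eq_or_lt_of_le hl with rfl | hlt
      · exact h1
      · exact h1' l hlt hlj

/-- `τ ⊨ ψ`. -/
def Sat {k : ℕ} (τ : Trace k) (ψ : Property k) : Prop := ψ.SatAt τ 0

/-- The four monitoring states: current and permanent satisfaction and violation. -/
inductive RV where
  | cs | ps | cv | pv

/-- `ψ` is in monitoring state `s` after the trace `τ`. -/
def InState {k : ℕ} (τ : Trace k) (ψ : Property k) : RV → Prop
  | .cs => Sat τ ψ ∧ ∃ τ' : Trace k, ¬ Sat (τ.append τ') ψ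
  | .ps => Sat τ ψ ∧ ∀ τ' : Trace k, Sat (τ.append τ') ψ
  | .cv => ¬ Sat τ ψ ∧ ∃ τ' : Trace k, Sat (τ.append τ') ψ
  | .pv => ¬ Sat τ ψ ∧ ∀ τ' : Trace k, ¬ Sat (τ.append τ') ψ

/-! Explicit codings of the inputs and the output of a monitor. -/

/-- The four monitoring states, numbered. -/
def RV.equivFin : RV ≃ Fin 4 where
  toFun
    | .cs => 0
    | .ps => 1
    | .cv => 2
    | .pv => 3
  invFun
    | 0 => .cs
    | 1 => .ps
    | 2 => .cv
    | 3 => .pv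
  left_inv s := by cases s <;> rfl
  right_inv i := by fin_cases i <;> rfl

instance : Primcodable RV := Primcodable.ofEquiv (Fin 4) RV.equivFin

/-- The number of a comparison operator. -/
def Rel.code : Rel → ℕ
  | .eq => 0
  | .ne => 1
  | .le => 2
  | .lt => 3

/-- The Gödel number of a term. -/
def Term.code {k : ℕ} : Term k → ℕ
  | .const d => Nat.pair 0 (Equiv.intEquivNat d)
  | .var v j => Nat.pair 1 (Nat.pair v j)

/-- The Gödel number of a monotonicity constraint. -/
def MC.code {k : ℕ} (c : MC k) : ℕ := Nat.pair c.rel.code (Nat.pair c.lhs.code c.rhs.code)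

/-- The Gödel number of a property. -/
def Property.code {k : ℕ} : Property k → ℕ
  | .atom c => Nat.pair 0 c.code
  | .and ψ₁ ψ₂ => Nat.pair 1 (Nat.pair ψ₁.code ψ₂.code)
  | .not ψ => Nat.pair 2 ψ.code
  | .next ψ => Nat.pair 3 ψ.code
  | .untl ψ₁ ψ₂ => Nat.pair 4 (Nat.pair ψ₁.code ψ₂.code)

/-- A trace as a list of rows; each row lists the values of the variables `0, …, k - 1`. -/
def Trace.rows {k : ℕ} (τ : Trace k) : List (List ℤ) := τ.1.map List.ofFn

end ALTLf

/-! The monitoring state of `ψ` is determined by whether `τ` satisfies `ψ` and whether some proper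
extension of `τ` satisfies `ψ`, respectively its negation. The first question is settled by
evaluation. The second becomes a finite search by a small-model property: if a satisfying extension
exists, one exists whose length and values are bounded by a computable function of `ψ` and `τ`.

Let `N` bound the Gödel number of the property (hence all its constants and lookaheads), the number
of variables, and the length and values of `τ`. The type of an instant consists of the order type of
the next `N + 1` assignments together with the integers in `[-N, N]`, and of the properties with
code at most `N` that hold there. There are at most `typeBound N` types, so a long trace repeats a
type after `τ` (`exists_same_type`), and the segment between the two instants can be removed
(`exists_cut`).

The two remaining pieces need not fit together literally: their windows agree only in order.
However, atoms compare values without offsets, so only order matters. Both pieces are embedded into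
`ℤ ×ₗ ℤ` so that the windows coincide (`exists_amalgam`), and the finitely many values used are
mapped back to `ℤ` by their rank (`exists_strictMonoOn_int`). All integers in `[-N, N]` are matched
as constants, so nothing is inserted between them and the rank map can fix them. The same rank map
bounds the values of a short trace (`exists_small`).

Evaluation and search are primitive recursive on codes: truth tables are built by recursion on the
Gödel number, and extensions are sought up to an explicit code bound. -/

namespace ALTLf

/-! ### Compressing finite sets of values -/

/-- A finite subset `S` of a linear order that contains a chain of points `c d`, `|d| ≤ M`, without
further elements of `S` in between, embeds into `ℤ` with `c d ↦ d` and values of size at most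
`S.card`. -/
theorem exists_strictMonoOn_int {X : Type*} [LinearOrder X] (S : Finset X) (M : ℕ) (c : ℤ → X)
    (hc : StrictMonoOn c (Set.Icc (-M : ℤ) M)) (hcS : ∀ d ∈ Set.Icc (-M : ℤ) M, c d ∈ S)
    (hS : ∀ x ∈ S, x < c (-M) ∨ (∃ d ∈ Set.Icc (-M : ℤ) M, x = c d) ∨ c M < x) :
    ∃ f : X → ℤ, StrictMonoOn f S ∧ (∀ d ∈ Set.Icc (-M : ℤ) M, f (c d) = d) ∧
      ∀ x, |f x| ≤ S.card := by
  -- The map is the rank in `S`, shifted to vanish at `c 0`. Since nothing in `S` lies between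
  -- consecutive chain points, the rank grows by exactly one along the chain.
  set N : X → ℕ := fun x => (S.filter (· ≤ x)).card with hN
  have hlow : (-M : ℤ) ∈ Set.Icc (-M : ℤ) M := ⟨le_rfl, by omega⟩
  have hcount : ∀ d ∈ Set.Icc (-M : ℤ) M,
      (N (c d) : ℤ) = (S.filter (· < c (-M))).card + (d + M + 1) := by
    intro d hd
    have hsplit : S.filter (· ≤ c d) =
        S.filter (· < c (-M)) ∪ (Finset.Icc (-M : ℤ) d).image c := by
      ext x
      simp only [Finset.mem_filter, Finset.mem_union, Finset.mem_image, Finset.mem_Icc]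
      constructor
      · rintro ⟨hx, hxd⟩
        rcases hS x hx with h | ⟨e, he, rfl⟩ | h
        · exact Or.inl ⟨hx, h⟩
        · exact Or.inr ⟨e, ⟨he.1, (hc.le_iff_le he hd).1 hxd⟩, rfl⟩
        · exact absurd (h.trans_le hxd)
            (not_lt.2 (hc.monotoneOn hd ⟨by omega, le_rfl⟩ hd.2))
      · rintro (⟨hx, h⟩ | ⟨e, he, rfl⟩)
        · exact ⟨hx, h.le.trans (hc.monotoneOn hlow hd hd.1)⟩
        · have he' : e ∈ Set.Icc (-M : ℤ) M := ⟨he.1, he.2.trans hd.2⟩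
          exact ⟨hcS e he', hc.monotoneOn he' hd he.2⟩
    have hdisj : Disjoint (S.filter (· < c (-M))) ((Finset.Icc (-M : ℤ) d).image c) := by
      rw [Finset.disjoint_left]
      intro x hx hx'
      obtain ⟨e, he, rfl⟩ := Finset.mem_image.1 hx'
      rw [Finset.mem_Icc] at he
      exact absurd (Finset.mem_filter.1 hx).2
        (not_lt.2 (hc.monotoneOn hlow ⟨he.1, he.2.trans hd.2⟩ he.1))
    have hinj : Set.InjOn c (Finset.Icc (-M : ℤ) d) := by
      refine hc.injOn.mono fun e he => ?_
      rw [Finset.coe_Icc] at he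
      exact ⟨he.1, he.2.trans hd.2⟩
    have hcard : ((d + 1 - -M).toNat : ℤ) = d + M + 1 := by
      have := hd.1
      omega
    rw [hN]
    simp only [hsplit]
    rw [Finset.card_union_of_disjoint hdisj, Finset.card_image_of_injOn hinj, Int.card_Icc]
    push_cast [hcard]
    ring
  have h0 : (0 : ℤ) ∈ Set.Icc (-M : ℤ) M := ⟨by omega, by omega⟩
  refine ⟨fun x => N x - N (c 0), ?_, ?_, ?_⟩
  · intro x hx y hy hxy
    have : N x < N y := by
      refine Finset.card_lt_card (Finset.ssubset_iff_of_subset ?_ |>.2 ⟨y, ?_, ?_⟩)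
      · intro z hz
        rw [Finset.mem_filter] at hz ⊢
        exact ⟨hz.1, hz.2.trans hxy.le⟩
      · exact Finset.mem_filter.2 ⟨hy, le_rfl⟩
      · exact fun h => absurd hxy (not_lt.2 (Finset.mem_filter.1 h).2)
    simp only
    omega
  · intro d hd
    simp only
    rw [hcount d hd, hcount 0 h0]
    ring
  · intro x
    have h1 : N x ≤ S.card := Finset.card_filter_le _ _
    have h2 : N (c 0) ≤ S.card := Finset.card_filter_le _ _
    simp only [abs_le]
    omega

/-! ### Bounds for the parts of a coded property -/

/-- The constants and lookaheads of a term are at most `C`. -/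
def Term.Bounded {k : ℕ} (C : ℕ) : Term k → Prop
  | .const d => d ∈ Set.Icc (-C : ℤ) C
  | .var _ j => j ≤ C

theorem intEquivNat_natCast (n : ℕ) : Equiv.intEquivNat (n : ℤ) = 2 * n := rfl

theorem intEquivNat_negSucc (n : ℕ) : Equiv.intEquivNat (Int.negSucc n) = 2 * n + 1 := rfl

theorem abs_le_intEquivNat (d : ℤ) : |d| ≤ Equiv.intEquivNat d := by
  cases d with
  | ofNat n =>
    have := intEquivNat_natCast n
    simp only [Int.ofNat_eq_natCast, this]
    rw [abs_of_nonneg] <;> push_cast <;> omega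
  | negSucc n =>
    rw [intEquivNat_negSucc, abs_of_neg (Int.negSucc_lt_zero n)]
    omega

/-- Pairing dominates both components, so a single Gödel number serves as a bound for constants,
lookaheads and codes of subformulas. -/
theorem Term.bounded_code {k : ℕ} (t : Term k) : t.Bounded t.code := by
  cases t with
  | const d =>
    have h1 := abs_le.1 (abs_le_intEquivNat d)
    have h2 := Nat.right_le_pair 0 (Equiv.intEquivNat d)
    simp only [Term.Bounded, Term.code, Set.mem_Icc]
    omega
  | var v j => exact (Nat.right_le_pair v j).trans (Nat.right_le_pair 1 _)

theorem Term.Bounded.mono {k : ℕ} {t : Term k} {C D : ℕ} (h : t.Bounded C) (hCD : C ≤ D) :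
    t.Bounded D := by
  cases t with
  | const d =>
    simp only [Term.Bounded, Set.mem_Icc] at h ⊢
    omega
  | var v j => exact le_trans (show j ≤ C from h) hCD

theorem MC.lhs_bounded {k : ℕ} (c : MC k) {C : ℕ} (h : c.code ≤ C) : c.lhs.Bounded C :=
  c.lhs.bounded_code.mono
    (((Nat.left_le_pair _ _).trans (Nat.right_le_pair c.rel.code _)).trans h)

theorem MC.rhs_bounded {k : ℕ} (c : MC k) {C : ℕ} (h : c.code ≤ C) : c.rhs.Bounded C :=
  c.rhs.bounded_code.mono
    (((Nat.right_le_pair _ _).trans (Nat.right_le_pair c.rel.code _)).trans h)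

/-! ### Transferring satisfaction between traces -/

theorem Rel.holds_congr {a b a' b' : ℤ} (r : Rel) (h₁ : a ≤ b ↔ a' ≤ b') (h₂ : b ≤ a ↔ b' ≤ a') :
    r.holds a b ↔ r.holds a' b' := by
  cases r <;> simp only [Rel.holds, le_antisymm_iff, ne_eq, lt_iff_le_not_ge, h₁, h₂]

/-- The satisfaction of an atom only depends on the order of the values that it refers to, relative
to each other and to the constants. -/
theorem MC.sat_map {k C p p' : ℕ} {σ σ' : Trace k} {A : Set ℤ} {f : ℤ → ℤ}
    (hf : StrictMonoOn f A) (hconst : ∀ d ∈ Set.Icc (-C : ℤ) C, d ∈ A ∧ f d = d)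
    (hlen : ∀ j ≤ C, p + j < σ.length ↔ p' + j < σ'.length)
    (hval : ∀ j ≤ C, p + j < σ.length → ∀ v : Fin k,
      σ.1.getD (p + j) 0 v ∈ A ∧ σ'.1.getD (p' + j) 0 v = f (σ.1.getD (p + j) 0 v))
    (c : MC k) (hc : c.code ≤ C) : c.Sat σ p ↔ c.Sat σ' p' := by
  have hwd : ∀ t : Term k, t.Bounded C → (t.WellDefined σ p ↔ t.WellDefined σ' p') := by
    rintro (d | ⟨v, j⟩) ht
    · exact Iff.rfl
    · exact hlen j ht
  have hev : ∀ t : Term k, t.Bounded C → t.WellDefined σ p →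
      t.eval σ p ∈ A ∧ t.eval σ' p' = f (t.eval σ p) := by
    rintro (d | ⟨v, j⟩) ht hw
    · exact ⟨(hconst d ht).1, (hconst d ht).2.symm⟩
    · exact hval j ht hw v
  have hl := c.lhs_bounded hc
  have hr := c.rhs_bounded hc
  have h0 := hlen 0 (Nat.zero_le _)
  simp only [MC.Sat, Nat.add_zero] at h0 ⊢
  rw [h0, hwd _ hl, hwd _ hr]
  refine and_congr_right fun _ => ?_
  by_cases hw : c.lhs.WellDefined σ' p' ∧ c.rhs.WellDefined σ' p'
  · obtain ⟨h1, h2⟩ := hev _ hl ((hwd _ hl).2 hw.1)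
    obtain ⟨h3, h4⟩ := hev _ hr ((hwd _ hr).2 hw.2)
    refine or_congr_right ?_
    rw [h2, h4]
    exact Rel.holds_congr _ (hf.le_iff_le h1 h3).symm (hf.le_iff_le h3 h1).symm
  · simp [hw]

theorem Property.left_lt_code (t a b : ℕ) (ht : 1 ≤ t) : a < Nat.pair t (Nat.pair a b) := by
  have h1 := Nat.left_le_pair a b
  have h2 := Nat.add_le_pair t (Nat.pair a b)
  omega

theorem Property.right_lt_code (t a b : ℕ) (ht : 1 ≤ t) : b < Nat.pair t (Nat.pair a b) := by
  have h1 := Nat.right_le_pair a b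
  have h2 := Nat.add_le_pair t (Nat.pair a b)
  omega

theorem Property.sub_lt_code (t a : ℕ) (ht : 1 ≤ t) : a < Nat.pair t a := by
  have h2 := Nat.add_le_pair t a
  omega

/-- All operators look forward only, so truth at an instant depends on the atoms from there on and
on the distance to the end of the trace. -/
theorem Property.satAt_shift {k C i d : ℕ} {σ σ' : Trace k} (hn : σ'.length + d = σ.length)
    (hatom : ∀ p, i ≤ p → ∀ c : MC k, c.code ≤ C → (c.Sat σ' p ↔ c.Sat σ (p + d)))
    (φ : Property k) (hφ : φ.code ≤ C) (p : ℕ) (hp : i ≤ p) :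
    φ.SatAt σ' p ↔ φ.SatAt σ (p + d) := by
  induction φ generalizing p with
  | atom c => exact hatom p hp c ((Nat.right_le_pair 0 _).trans hφ)
  | and φ₁ φ₂ ih₁ ih₂ =>
    exact and_congr (ih₁ ((left_lt_code 1 _ _ le_rfl).le.trans hφ) p hp)
      (ih₂ ((right_lt_code 1 _ _ le_rfl).le.trans hφ) p hp)
  | not φ ih => exact not_congr (ih ((sub_lt_code 2 _ (by omega)).le.trans hφ) p hp)
  | next φ ih =>
    refine and_congr (by omega) ?_
    rw [ih ((sub_lt_code 3 _ (by omega)).le.trans hφ) (p + 1) (by omega), Nat.add_right_comm]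
  | untl φ₁ φ₂ ih₁ ih₂ =>
    replace ih₁ := ih₁ ((left_lt_code 4 _ _ (by omega)).le.trans hφ)
    replace ih₂ := ih₂ ((right_lt_code 4 _ _ (by omega)).le.trans hφ)
    simp only [SatAt]
    constructor
    · rintro ⟨j, hpj, hj, h2, h1⟩
      refine ⟨j + d, by omega, by omega, (ih₂ j (by omega)).1 h2, fun l hl hlj => ?_⟩
      obtain ⟨l, rfl⟩ := Nat.exists_eq_add_of_le' (show d ≤ l by omega)
      exact (ih₁ l (by omega)).1 (h1 l (by omega) (by omega))
    · rintro ⟨j, hpj, hj, h2, h1⟩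
      obtain ⟨j, rfl⟩ := Nat.exists_eq_add_of_le' (show d ≤ j by omega)
      exact ⟨j, by omega, by omega, (ih₂ j (by omega)).2 h2,
        fun l hl hlj => (ih₁ l (by omega)).2 (h1 (l + d) (by omega) (by omega))⟩

theorem Property.satAt_congr {k C : ℕ} {σ σ' : Trace k} (hn : σ'.length = σ.length)
    (hatom : ∀ p, ∀ c : MC k, c.code ≤ C → (c.Sat σ' p ↔ c.Sat σ p))
    (φ : Property k) (hφ : φ.code ≤ C) (p : ℕ) : φ.SatAt σ' p ↔ φ.SatAt σ p :=
  satAt_shift (i := 0) (d := 0) hn (fun p _ => hatom p) φ hφ p (Nat.zero_le _)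

/-- Here `σ'` is `σ` with `d` instants removed at `i`. At `i`, the shift lemma gives the truth
values of `σ` at `i + d`, which `htype` identifies with those at `i`. Before `i`, agreement
propagates backwards. -/
theorem Property.satAt_cut {k C i d : ℕ} {σ σ' : Trace k} (hn : σ'.length + d = σ.length)
    (hi : i < σ'.length)
    (hatom : ∀ p, i ≤ p → ∀ c : MC k, c.code ≤ C → (c.Sat σ' p ↔ c.Sat σ (p + d)))
    (hatom' : ∀ p, p < i → ∀ c : MC k, c.code ≤ C → (c.Sat σ' p ↔ c.Sat σ p))
    (htype : ∀ φ : Property k, φ.code ≤ C → (φ.SatAt σ i ↔ φ.SatAt σ (i + d)))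
    (φ : Property k) (hφ : φ.code ≤ C) (p : ℕ) (hp : p ≤ i) :
    φ.SatAt σ' p ↔ φ.SatAt σ p := by
  have hend : ∀ φ : Property k, φ.code ≤ C → (φ.SatAt σ' i ↔ φ.SatAt σ i) := fun φ hφ =>
    (satAt_shift hn hatom φ hφ i le_rfl).trans (htype φ hφ).symm
  induction φ generalizing p with
  | atom c =>
    rcases hp.eq_or_lt with rfl | hp
    · exact hend _ hφ
    · exact hatom' p hp c ((Nat.right_le_pair 0 _).trans hφ)
  | and φ₁ φ₂ ih₁ ih₂ =>
    exact and_congr (ih₁ ((left_lt_code 1 _ _ le_rfl).le.trans hφ) p hp)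
      (ih₂ ((right_lt_code 1 _ _ le_rfl).le.trans hφ) p hp)
  | not φ ih => exact not_congr (ih ((sub_lt_code 2 _ (by omega)).le.trans hφ) p hp)
  | next φ ih =>
    rcases hp.eq_or_lt with rfl | hp
    · exact hend _ hφ
    · exact and_congr (by omega)
        (ih ((sub_lt_code 3 _ (by omega)).le.trans hφ) (p + 1) (by omega))
  | untl φ₁ φ₂ ih₁ ih₂ =>
    replace ih₁ := ih₁ ((left_lt_code 4 _ _ (by omega)).le.trans hφ)
    replace ih₂ := ih₂ ((right_lt_code 4 _ _ (by omega)).le.trans hφ)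
    -- The witness of an until may lie beyond the cut, so the operator is unfolded one instant at a
    -- time, descending from `i`.
    induction hp using Nat.decreasingInduction with
    | self => exact hend _ hφ
    | of_succ p hp ih =>
      refine (satAt_until_iff σ' φ₁ φ₂ p).trans (Iff.trans ?_ (satAt_until_iff σ φ₁ φ₂ p).symm)
      exact and_congr (by omega) (or_congr (ih₂ p hp.le) (and_congr (by omega)
        (and_congr (ih₁ p hp.le) ih)))

/-! ### Short extensions with small values -/

/-- The values of the window of `N + 1` assignments from instant `i` on, together with the integers
of size at most `N`. -/
def windowVal {k : ℕ} (σ : Trace k) (N i : ℕ) :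
    (Fin k × Fin (N + 1)) ⊕ Finset.Icc (-N : ℤ) N → ℤ
  | .inl x => σ.1.getD (i + x.2) 0 x.1
  | .inr d => d

/-- Two order-equivalent finite families of integers can be amalgamated: there is a linear order
with two strictly monotone maps that identify the families. -/
theorem exists_amalgam {I : Type*} [Finite I] (u v : I → ℤ)
    (h : ∀ a b, u a ≤ u b ↔ v a ≤ v b) :
    ∃ g h : ℤ → ℤ ×ₗ ℤ, StrictMono g ∧ StrictMono h ∧ (∀ a, g (u a) = h (v a)) := by
  have huv : ∀ a b, u a = u b ↔ v a = v b := fun a b => by simp only [le_antisymm_iff, h]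
  have hu : Function.FactorsThrough v u := fun a b hab => (huv a b).1 hab
  have hv : Function.FactorsThrough u v := fun a b hab => (huv a b).2 hab
  have hmono : MonotoneOn (Function.extend v u 0) (Set.range v) := by
    rintro _ ⟨a, rfl⟩ _ ⟨b, rfl⟩ hab
    rw [hv.extend_apply, hv.extend_apply]
    exact (h a b).2 hab
  have hfin : (Function.extend v u 0 '' Set.range v).Finite := (Set.finite_range v).image _
  obtain ⟨s, hs, hsv⟩ := hmono.exists_monotone_extension hfin.bddBelow hfin.bddAbove
  -- `s` is a monotone extension of `v a ↦ u a`. The first coordinate alone makes the first map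
  -- strictly monotone, whatever the default in the second; in the second map the second coordinate
  -- breaks the ties of `s`. Both families become `(u a, v a)`.
  refine ⟨fun x => toLex (x, Function.extend u v 0 x), fun y => toLex (s y, y), ?_, ?_, ?_⟩
  · intro x y hxy
    exact Prod.Lex.toLex_lt_toLex.2 (Or.inl hxy)
  · intro x y hxy
    rcases (hs hxy.le).lt_or_eq with h | h
    · exact Prod.Lex.toLex_lt_toLex.2 (Or.inl h)
    · exact Prod.Lex.toLex_lt_toLex.2 (Or.inr ⟨h, hxy⟩)
  · intro a
    simp only
    rw [hu.extend_apply, ← hsv ⟨a, rfl⟩, hv.extend_apply]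

/-- The values of a trace. -/
def Trace.values {k : ℕ} (σ : Trace k) : Finset ℤ :=
  (Finset.univ : Finset (Fin σ.length × Fin k)).image fun x => σ.1.getD x.1 0 x.2

theorem Trace.mem_values {k : ℕ} (σ : Trace k) {q : ℕ} (hq : q < σ.length) (v : Fin k) :
    σ.1.getD q 0 v ∈ σ.values :=
  Finset.mem_image.2 ⟨(⟨q, hq⟩, v), Finset.mem_univ _, rfl⟩

theorem Trace.card_values_le {k : ℕ} (σ : Trace k) : σ.values.card ≤ σ.length * k :=
  Finset.card_image_le.trans (by simp)

/-- The trace of length `n + 1` with the given assignments. -/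
def Trace.ofFun {k : ℕ} (n : ℕ) (w : ℕ → Assignment k) : Trace k :=
  ⟨(List.range (n + 1)).map w, by simp⟩

theorem Trace.length_ofFun {k : ℕ} (n : ℕ) (w : ℕ → Assignment k) :
    (Trace.ofFun n w).length = n + 1 := by
  simp [Trace.ofFun, Trace.length]

theorem Trace.getD_ofFun {k : ℕ} (n : ℕ) (w : ℕ → Assignment k) {q : ℕ} (hq : q < n + 1) :
    (Trace.ofFun n w).1.getD q 0 = w q := by
  simp [Trace.ofFun, List.getD_eq_getElem?_getD, hq]

/-- Between two instants of the same type, a trace can be cut. -/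
theorem exists_cut {k N i d m : ℕ} (σ : Trace k) (hlen : i + d + (N + 1) ≤ σ.length)
    (horder : ∀ a b, windowVal σ N i a ≤ windowVal σ N i b ↔
      windowVal σ N (i + d) a ≤ windowVal σ N (i + d) b)
    (htype : ∀ φ : Property k, φ.code ≤ N → (φ.SatAt σ i ↔ φ.SatAt σ (i + d)))
    (hm : m ≤ i) (hprefix : ∀ q < m, ∀ v, σ.1.getD q 0 v ∈ Set.Icc (-N : ℤ) N) :
    ∃ σ' : Trace k, σ'.length + d = σ.length ∧
      (∀ q < m, σ'.1.getD q 0 = σ.1.getD q 0) ∧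
      ∀ φ : Property k, φ.code ≤ N → (φ.SatAt σ' 0 ↔ φ.SatAt σ 0) := by
  obtain ⟨g, h, hg, hh, hgh⟩ := exists_amalgam _ _ horder
  have hconst : ∀ x ∈ Set.Icc (-N : ℤ) N, g x = h x := fun x hx =>
    hgh (.inr ⟨x, Finset.mem_Icc.2 hx⟩)
  have hwin : ∀ j ≤ N, ∀ v : Fin k,
      g (σ.1.getD (i + j) 0 v) = h (σ.1.getD (i + d + j) 0 v) := fun j hj v =>
    hgh (.inl (v, ⟨j, by omega⟩))
  have hlow : (-N : ℤ) ∈ Set.Icc (-N : ℤ) N := ⟨le_rfl, by omega⟩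
  have hhigh : (N : ℤ) ∈ Set.Icc (-N : ℤ) N := ⟨by omega, le_rfl⟩
  set K := σ.values ∪ Finset.Icc (-N : ℤ) N with hK
  have hKg : ∀ x ∈ K, g x ∈ K.image g ∪ K.image h := fun x hx =>
    Finset.mem_union_left _ (Finset.mem_image_of_mem _ hx)
  have hKh : ∀ x ∈ K, h x ∈ K.image g ∪ K.image h := fun x hx =>
    Finset.mem_union_right _ (Finset.mem_image_of_mem _ hx)
  have hKc : ∀ x ∈ Set.Icc (-N : ℤ) N, x ∈ K := fun x hx =>
    Finset.mem_union_right _ (Finset.mem_Icc.2 hx)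
  have hKv : ∀ q < σ.length, ∀ v, σ.1.getD q 0 v ∈ K := fun q hq v =>
    Finset.mem_union_left _ (σ.mem_values hq v)
  obtain ⟨f, hf, hfc, -⟩ := exists_strictMonoOn_int (K.image g ∪ K.image h) N g
    (hg.strictMonoOn _) (fun d hd => hKg d (hKc d hd)) (by
      -- An integer that either map sends between the images of `-N` and `N` is itself in `[-N, N]`,
      -- where the two maps agree; so no further value separates the constants.
      have key : ∀ e : ℤ → ℤ ×ₗ ℤ, StrictMono e → (∀ x ∈ Set.Icc (-N : ℤ) N, g x = e x) →
          ∀ x, e x < g (-N) ∨ (∃ d ∈ Set.Icc (-N : ℤ) N, e x = g d) ∨ g N < e x := by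
        intro e he hge x
        rw [hge _ hlow, hge _ hhigh]
        rcases lt_or_ge x (-N) with h1 | h1
        · exact Or.inl (he h1)
        · rcases lt_or_ge (N : ℤ) x with h2 | h2
          · exact Or.inr (Or.inr (he h2))
          · exact Or.inr (Or.inl ⟨x, ⟨h1, h2⟩, (hge x ⟨h1, h2⟩).symm⟩)
      intro x hx
      rcases Finset.mem_union.1 hx with hx | hx <;> obtain ⟨y, -, rfl⟩ := Finset.mem_image.1 hx
      · exact key g hg (fun _ _ => rfl) y
      · exact key h hh hconst y)
  -- On the window from `i` to `i + N` both formulas agree. Atoms before `i` therefore see only the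
  -- first piece and atoms from `i` on only the second.
  set w : ℕ → Assignment k := fun q v =>
    if q < i + (N + 1) then f (g (σ.1.getD q 0 v)) else f (h (σ.1.getD (q + d) 0 v)) with hw
  set n := σ.length - d - 1 with hn
  have hlen' := Trace.length_ofFun n w
  have hfst : ∀ q < i + (N + 1), ∀ v,
      (Trace.ofFun n w).1.getD q 0 v = f (g (σ.1.getD q 0 v)) := by
    intro q hq v
    rw [Trace.getD_ofFun n w (by omega), hw]
    simp only [if_pos hq]
  have hsnd : ∀ q, i ≤ q → q < n + 1 → ∀ v,
      (Trace.ofFun n w).1.getD q 0 v = f (h (σ.1.getD (q + d) 0 v)) := by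
    intro q hq hqn v
    by_cases hqi : q < i + (N + 1)
    · obtain ⟨j, rfl⟩ := Nat.exists_eq_add_of_le hq
      rw [hfst _ hqi, hwin j (by omega), Nat.add_right_comm]
    · rw [Trace.getD_ofFun n w hqn, hw]
      simp only [if_neg hqi]
  have hfg : StrictMonoOn (f ∘ g) K := fun x hx y hy hxy => hf (hKg x hx) (hKg y hy) (hg hxy)
  have hfh : StrictMonoOn (f ∘ h) K := fun x hx y hy hxy => hf (hKh x hx) (hKh y hy) (hh hxy)
  refine ⟨Trace.ofFun n w, by omega, ?_, fun φ hφ => ?_⟩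
  · intro q hq
    funext v
    rw [hfst q (by omega), hfc _ (hprefix q hq v)]
  · refine Property.satAt_cut (by omega) (by omega) ?_ ?_ htype φ hφ 0 (Nat.zero_le _)
    · intro p hp c hc
      refine (MC.sat_map hfh (fun x hx => ⟨hKc x hx, ?_⟩) (fun j hj => ?_) (fun j hj hj' v => ?_)
        c hc).symm
      · rw [Function.comp_apply, ← hconst x hx, hfc x hx]
      · omega
      · refine ⟨hKv _ hj' v, ?_⟩
        rw [hsnd _ (by omega) (by omega), Nat.add_right_comm]
        rfl
    · intro p hp c hc
      refine (MC.sat_map hfg (fun x hx => ⟨hKc x hx, hfc x hx⟩) (fun j hj => ?_)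
        (fun j hj hj' v => ?_) c hc).symm
      · omega
      · exact ⟨hKv _ hj' v, hfst _ (by omega) v⟩

/-! ### Counting types of instants -/

/-- A bound for the number of types of instants. -/
def typeBound (N : ℕ) : ℕ := 2 ^ (N + 1) * 2 ^ ((N * (N + 1) + (2 * N + 1)) ^ 2)

theorem Term.code_injective {k : ℕ} : Function.Injective (Term.code (k := k)) := by
  rintro (d | ⟨v, j⟩) (d' | ⟨v', j'⟩) h <;>
    simp only [Term.code, Nat.pair_eq_pair, Fin.val_inj, EmbeddingLike.apply_eq_iff_eq] at h <;>
    simp_all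

theorem Rel.code_injective : Function.Injective Rel.code := by
  rintro (_ | _) (_ | _) h <;> first | rfl | exact absurd h (by decide)

theorem MC.code_injective {k : ℕ} : Function.Injective (MC.code (k := k)) := by
  rintro ⟨r, s, t⟩ ⟨r', s', t'⟩ h
  simp only [MC.code, Nat.pair_eq_pair] at h
  rw [Rel.code_injective h.1, Term.code_injective h.2.1, Term.code_injective h.2.2]

/-- Types record truth by code; injectivity recovers the truth of the property itself. -/
theorem Property.code_injective {k : ℕ} : Function.Injective (Property.code (k := k)) := by
  intro φ
  induction φ with
  | atom c =>
    rintro (_ | _) h <;> simp [Property.code] at h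
    rw [MC.code_injective h]
  | and φ₁ φ₂ ih₁ ih₂ =>
    rintro (_ | _) h <;> simp [Property.code] at h
    rw [ih₁ h.1, ih₂ h.2]
  | not φ ih =>
    rintro (_ | _) h <;> simp [Property.code] at h
    rw [ih h]
  | next φ ih =>
    rintro (_ | _) h <;> simp [Property.code] at h
    rw [ih h]
  | untl φ₁ φ₂ ih₁ ih₂ =>
    rintro (_ | _) h <;> simp [Property.code] at h
    rw [ih₁ h.1, ih₂ h.2]

/-- In a long trace, two instants have the same type. -/
theorem exists_same_type {k N m : ℕ} (σ : Trace k) (hk : k ≤ N)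
    (hlen : m + typeBound N + (N + 1) ≤ σ.length) :
    ∃ i d, m ≤ i ∧ 0 < d ∧ i + d + (N + 1) ≤ σ.length ∧
      (∀ a b, windowVal σ N i a ≤ windowVal σ N i b ↔
        windowVal σ N (i + d) a ≤ windowVal σ N (i + d) b) ∧
      ∀ φ : Property k, φ.code ≤ N → (φ.SatAt σ i ↔ φ.SatAt σ (i + d)) := by
  let I := (Fin k × Fin (N + 1)) ⊕ Finset.Icc (-N : ℤ) N
  let type : ℕ → (Fin (N + 1) → Prop) × (I × I → Prop) := fun i =>
    (fun e => ∃ φ : Property k, φ.code = e ∧ φ.SatAt σ i,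
      fun x => windowVal σ N i x.1 ≤ windowVal σ N i x.2)
  classical
  have hI : Fintype.card I ≤ N * (N + 1) + (2 * N + 1) := by
    have h1 : Fintype.card I = k * (N + 1) + (2 * N + 1) := by
      simp only [I, Fintype.card_sum, Fintype.card_prod, Fintype.card_fin, Fintype.card_coe,
        Int.card_Icc]
      omega
    rw [h1]
    gcongr
  have hcard : Fintype.card ((Fin (N + 1) → Prop) × (I × I → Prop)) ≤ typeBound N := by
    simp only [Fintype.card_prod, Fintype.card_fun, Fintype.card_fin, Fintype.card_prop, typeBound,
      ← sq]
    gcongr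
    norm_num
  -- Pigeonhole on `typeBound N + 1` instants from `m` on, each of which still has a full window
  -- before the end.
  obtain ⟨x, hx, y, hy, hxy, htype⟩ := Finset.exists_ne_map_eq_of_card_lt_of_maps_to
    (s := Finset.Icc m (m + typeBound N)) (t := Finset.univ) (f := type)
    (by rw [Finset.card_univ, Nat.card_Icc]; omega) (fun _ _ => Finset.mem_coe.2 (Finset.mem_univ _))
  rw [Finset.mem_Icc] at hx hy
  have key : ∀ x y, m ≤ x → x < y → y ≤ m + typeBound N → type x = type y → ∃ i d, m ≤ i ∧ 0 < d ∧
      i + d + (N + 1) ≤ σ.length ∧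
      (∀ a b, windowVal σ N i a ≤ windowVal σ N i b ↔
        windowVal σ N (i + d) a ≤ windowVal σ N (i + d) b) ∧
      ∀ φ : Property k, φ.code ≤ N → (φ.SatAt σ i ↔ φ.SatAt σ (i + d)) := by
    intro x y hx hxy hy htype
    obtain ⟨d, rfl⟩ := Nat.exists_eq_add_of_le hxy.le
    refine ⟨x, d, hx, by omega, by omega, fun a b => ?_, fun φ hφ => ?_⟩
    · exact iff_of_eq (congrFun (Prod.ext_iff.1 htype).2 (a, b))
    · have h1 := iff_of_eq (congrFun (Prod.ext_iff.1 htype).1 ⟨φ.code, by omega⟩)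
      have h2 : ∀ i, (∃ φ' : Property k, φ'.code = φ.code ∧ φ'.SatAt σ i) ↔ φ.SatAt σ i :=
        fun i => ⟨fun ⟨φ', h, hs⟩ => Property.code_injective h ▸ hs, fun hs => ⟨φ, rfl, hs⟩⟩
      exact (h2 x).symm.trans (h1.trans (h2 (x + d)))
  rcases hxy.lt_or_gt with h | h
  · exact key x y hx.1 h hy.2 htype
  · exact key y x hy.1 h hx.2 htype.symm

/-- A bound for the length of extensions. -/
def lengthBound (N : ℕ) : ℕ := N + typeBound N + (N + 1)

/-- A trace can be shortened, and its values can be bounded, without changing a prefix of small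
values and the satisfaction of small properties. -/
theorem exists_small {k N m : ℕ} (hk : k ≤ N) (hm : m ≤ N) (σ : Trace k) (hmσ : m < σ.length)
    (hprefix : ∀ q < m, ∀ v, σ.1.getD q 0 v ∈ Set.Icc (-N : ℤ) N) :
    ∃ σ' : Trace k, m < σ'.length ∧ σ'.length ≤ lengthBound N ∧
      (∀ q < σ'.length, ∀ v, |σ'.1.getD q 0 v| ≤ lengthBound N * N + (2 * N + 1)) ∧
      (∀ q < m, σ'.1.getD q 0 = σ.1.getD q 0) ∧
      ∀ φ : Property k, φ.code ≤ N → (φ.SatAt σ' 0 ↔ φ.SatAt σ 0) := by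
  induction hl : σ.length using Nat.strong_induction_on generalizing σ with
  | _ l ih =>
    subst hl
    rcases le_or_gt σ.length (lengthBound N) with hshort | hlong
    -- A short trace is not cut: replacing values by ranks fixes the constants and the prefix, and
    -- bounds all values by the size of `K`.
    · set K := σ.values ∪ Finset.Icc (-N : ℤ) N with hK
      have hKc : ∀ x ∈ Set.Icc (-N : ℤ) N, x ∈ K := fun x hx =>
        Finset.mem_union_right _ (Finset.mem_Icc.2 hx)
      have hKv : ∀ q < σ.length, ∀ v, σ.1.getD q 0 v ∈ K := fun q hq v =>
        Finset.mem_union_left _ (σ.mem_values hq v)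
      obtain ⟨f, hf, hfc, hfK⟩ := exists_strictMonoOn_int K N id (strictMono_id.strictMonoOn _) hKc
        (by
          intro x _
          simp only [id, Set.mem_Icc, exists_eq_right']
          omega)
      have hcard : K.card ≤ lengthBound N * N + (2 * N + 1) := by
        refine (Finset.card_union_le _ _).trans (Nat.add_le_add ?_ ?_)
        · exact σ.card_values_le.trans (Nat.mul_le_mul hshort hk)
        · rw [Int.card_Icc]
          omega
      set w : ℕ → Assignment k := fun q v => f (σ.1.getD q 0 v) with hw
      have hlen : (Trace.ofFun (σ.length - 1) w).length = σ.length := by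
        rw [Trace.length_ofFun]
        omega
      have hget : ∀ q < σ.length, ∀ v,
          (Trace.ofFun (σ.length - 1) w).1.getD q 0 v = f (σ.1.getD q 0 v) := fun q hq v => by
        rw [Trace.getD_ofFun _ w (by omega)]
      refine ⟨Trace.ofFun (σ.length - 1) w, by omega, by omega, fun q hq v => ?_, fun q hq => ?_,
        fun φ hφ => ?_⟩
      · rw [hget q (by omega)]
        exact (hfK _).trans (by exact_mod_cast hcard)
      · funext v
        rw [hget q (by omega)]
        exact hfc _ (hprefix q hq v)
      · refine Property.satAt_congr hlen (fun p c hc => ?_) φ hφ 0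
        refine (MC.sat_map hf (fun x hx => ⟨hKc x hx, hfc x hx⟩) (fun j hj => by omega)
          (fun j hj hj' v => ⟨hKv _ hj' v, hget _ hj' v⟩) c hc).symm
    · obtain ⟨i, d, hi, hd, hid, horder, htype⟩ := exists_same_type (m := m) σ hk
        (by unfold lengthBound at hlong; omega)
      obtain ⟨σ₁, hlen, hpre, hsat⟩ := exists_cut σ hid horder htype hi hprefix
      obtain ⟨σ', h1, h2, h3, h4, h5⟩ := ih σ₁.length (by omega) σ₁ (by omega)
        (fun q hq v => by rw [hpre q hq]; exact hprefix q hq v) rfl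
      exact ⟨σ', h1, h2, h3, fun q hq => (h4 q hq).trans (hpre q hq),
        fun φ hφ => (h5 φ hφ).trans (hsat φ hφ)⟩

open Encodable

/-! ### A primitive recursive evaluator on codes -/

/-- The order of the integers on their codes. -/
def CodeLe (a b : ℕ) : Prop :=
  (a % 2 = 0 ∧ b % 2 = 0 ∧ a ≤ b) ∨ (a % 2 = 1 ∧ (b % 2 = 0 ∨ b ≤ a))

/-- Even codes `2n` stand for `n` and odd codes `2n + 1` for `-(n + 1)`, so the order is reversed on
odd codes. -/
theorem codeLe_intEquivNat (x y : ℤ) :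
    CodeLe (Equiv.intEquivNat x) (Equiv.intEquivNat y) ↔ x ≤ y := by
  unfold CodeLe
  cases x <;> cases y <;>
    simp only [Int.ofNat_eq_natCast, intEquivNat_natCast, intEquivNat_negSucc] <;> omega

/-- The meaning of a coded comparison operator on coded integers. -/
def CodeHolds (r a b : ℕ) : Prop :=
  (r = 0 ∧ a = b) ∨ (r = 1 ∧ a ≠ b) ∨ (r = 2 ∧ CodeLe a b) ∨ (r = 3 ∧ ¬ CodeLe b a)

theorem codeHolds_iff (r : Rel) (x y : ℤ) :
    CodeHolds r.code (Equiv.intEquivNat x) (Equiv.intEquivNat y) ↔ r.holds x y := by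
  cases r <;> simp [CodeHolds, Rel.code, Rel.holds, codeLe_intEquivNat]

/-- Well-definedness of a coded term at instant `p` of a trace of length `n`. -/
def CodeWellDefined (n p t : ℕ) : Prop := t.unpair.1 = 0 ∨ p + t.unpair.2.unpair.2 < n

/-- The coded value of a coded term. -/
def codeEval (R : List (List ℕ)) (p t : ℕ) : ℕ :=
  if t.unpair.1 = 0 then t.unpair.2
  else (R.getD (p + t.unpair.2.unpair.2) []).getD t.unpair.2.unpair.1 0

/-- Satisfaction of a coded atom. -/
def CodeAtom (R : List (List ℕ)) (p c : ℕ) : Prop :=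
  p < R.length ∧
    (¬ (CodeWellDefined R.length p c.unpair.2.unpair.1 ∧
        CodeWellDefined R.length p c.unpair.2.unpair.2) ∨
      CodeHolds c.unpair.1 (codeEval R p c.unpair.2.unpair.1) (codeEval R p c.unpair.2.unpair.2))

/-- The entry for the property with code `c` and instant `p` in a list of truth tables. -/
def Entry (H : List (List Bool)) (c p : ℕ) : Prop := (H.getD c []).getD p false = true

/-- The truth value at instant `p` of the property whose code is the length of the list `H` of the
truth tables of the properties with smaller codes. -/
def Step (R : List (List ℕ)) (H : List (List Bool)) (p : ℕ) : Prop :=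
  let t := H.length.unpair.1
  let x := H.length.unpair.2
  (t = 0 ∧ CodeAtom R p x) ∨
  (t = 1 ∧ Entry H x.unpair.1 p ∧ Entry H x.unpair.2 p) ∨
  (t = 2 ∧ ¬ Entry H x p) ∨
  (t = 3 ∧ p + 1 < R.length ∧ Entry H x (p + 1)) ∨
  (t = 4 ∧ ∃ j < R.length, p ≤ j ∧ Entry H x.unpair.2 j ∧
    ∀ l < j, p ≤ l → Entry H x.unpair.1 l)

open Classical in
/-- The truth table of the property whose code is the length of `H`. -/
noncomputable def truthTable (R : List (List ℕ)) (H : List (List Bool)) : List Bool :=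
  (List.range (R.length + 1)).map fun p => decide (Step R H p)

/-- The truth tables of the properties with codes below `c`. -/
noncomputable def tables (R : List (List ℕ)) (c : ℕ) : List (List Bool) :=
  Nat.rec [] (fun _ H => H ++ [truthTable R H]) c

theorem length_tables (R : List (List ℕ)) (c : ℕ) : (tables R c).length = c := by
  induction c with
  | zero => rfl
  | succ c ih =>
    change (tables R c ++ [truthTable R (tables R c)]).length = c + 1
    rw [List.length_append, ih, List.length_singleton]

theorem entry_tables (R : List (List ℕ)) {N c p : ℕ} (hc : c < N) (hp : p ≤ R.length) :
    Entry (tables R N) c p ↔ Step R (tables R c) p := by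
  induction N with
  | zero => omega
  | succ N ih =>
    change (List.getD (tables R N ++ [truthTable R (tables R N)]) c []).getD p false = true ↔ _
    rcases (Nat.lt_succ_iff.1 hc).lt_or_eq with h | rfl
    · rw [List.getD_append _ _ _ _ (by rwa [length_tables])]
      exact ih h
    · rw [List.getD_append_right _ _ _ _ (length_tables R c).le, length_tables]
      simp only [truthTable, List.getD_eq_getElem?_getD, Nat.sub_self, List.getElem?_cons_zero,
        Option.getD_some, List.getElem?_map, List.getElem?_range (Nat.lt_succ_iff.2 hp),
        Option.map_some, decide_eq_true_eq]

/-- The assignment with the given list of coded values. -/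
def decodeRow (k : ℕ) (row : List ℕ) : Assignment k := fun v => Equiv.intEquivNat.symm (row.getD v 0)

theorem codeEval_eq {k : ℕ} {R : List (List ℕ)} {σ : Trace k} (hR : σ.1 = R.map (decodeRow k))
    (p : ℕ) (t : Term k) : codeEval R p t.code = Equiv.intEquivNat (t.eval σ p) := by
  cases t with
  | const d => simp [codeEval, Term.code, Term.eval]
  | var v j =>
    -- The default row decodes to the default assignment, so lookup commutes with decoding even past
    -- the end.
    have h0 : (0 : Assignment k) = decodeRow k [] := by
      funext v
      exact ((Equiv.symm_apply_eq _).2 rfl).symm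
    simp only [codeEval, Term.code, Term.eval, Nat.unpair_pair, if_neg one_ne_zero]
    rw [hR, h0, List.getD_map, decodeRow, Equiv.apply_symm_apply]

theorem codeAtom_iff {k : ℕ} {R : List (List ℕ)} {σ : Trace k} (hR : σ.1 = R.map (decodeRow k))
    (p : ℕ) (c : MC k) : CodeAtom R p c.code ↔ c.Sat σ p := by
  have hlen : R.length = σ.length := by simp [Trace.length, hR]
  have hwd : ∀ t : Term k, CodeWellDefined σ.length p t.code ↔ t.WellDefined σ p := by
    rintro (d | ⟨v, j⟩) <;> simp [CodeWellDefined, Term.code, Term.WellDefined]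
  simp only [CodeAtom, MC.Sat, MC.code, Nat.unpair_pair, hlen, hwd, codeEval_eq hR, codeHolds_iff]

/-- Subformulas have smaller codes, so their tables are already present when an entry is computed.
Entries at numbers that code no property are irrelevant. -/
theorem entry_iff {k : ℕ} {R : List (List ℕ)} {σ : Trace k} (hR : σ.1 = R.map (decodeRow k))
    (φ : Property k) {N p : ℕ} (hN : φ.code < N) (hp : p ≤ R.length) :
    Entry (tables R N) φ.code p ↔ φ.SatAt σ p := by
  have hlen : R.length = σ.length := by simp [Trace.length, hR]
  rw [entry_tables R hN hp]
  clear hN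
  induction φ generalizing p with
  | atom c => simp [Step, length_tables, Property.code, codeAtom_iff hR, Property.SatAt]
  | and φ₁ φ₂ ih₁ ih₂ =>
    have h1 := (entry_tables R (Property.left_lt_code 1 φ₁.code φ₂.code le_rfl) hp).trans (ih₁ hp)
    have h2 := (entry_tables R (Property.right_lt_code 1 φ₁.code φ₂.code le_rfl) hp).trans (ih₂ hp)
    simp [Step, length_tables, Property.code, Property.SatAt, h1, h2]
  | not φ ih =>
    have h1 := (entry_tables R (Property.sub_lt_code 2 φ.code (by omega)) hp).trans (ih hp)
    simp [Step, length_tables, Property.code, Property.SatAt, h1]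
  | next φ ih =>
    simp only [Step, length_tables, Property.code, Property.SatAt, Nat.unpair_pair]
    simp only [OfNat.ofNat_ne_zero, OfNat.ofNat_ne_one, false_and, true_and, false_or,
      Nat.reduceEqDiff, or_false, hlen]
    refine and_congr_right fun h => ?_
    exact (entry_tables R (Property.sub_lt_code 3 φ.code (by omega)) (by omega)).trans
      (ih (by omega))
  | untl φ₁ φ₂ ih₁ ih₂ =>
    have h1 : ∀ q ≤ R.length, _ := fun q hq => (entry_tables R
      (Property.left_lt_code 4 φ₁.code φ₂.code (by omega)) hq).trans (ih₁ hq)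
    have h2 : ∀ q ≤ R.length, _ := fun q hq => (entry_tables R
      (Property.right_lt_code 4 φ₁.code φ₂.code (by omega)) hq).trans (ih₂ hq)
    simp only [Step, length_tables, Property.code, Property.SatAt, Nat.unpair_pair]
    simp only [OfNat.ofNat_ne_zero, OfNat.ofNat_ne_one, false_and, true_and, false_or,
      Nat.reduceEqDiff]
    constructor
    · rintro ⟨j, hj, hpj, hj2, hj1⟩
      exact ⟨j, hpj, by omega, (h2 j hj.le).1 hj2,
        fun l hl hlj => (h1 l (by omega)).1 (hj1 l hlj hl)⟩
    · rintro ⟨j, hpj, hj, hj2, hj1⟩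
      exact ⟨j, by omega, hpj, (h2 j (by omega)).2 hj2,
        fun l hlj hl => (h1 l (by omega)).2 (hj1 l hl hlj)⟩

/-! ### Primitive recursiveness of the evaluator -/

section Primrec

open Primrec

variable {α : Type*} [Primcodable α]

theorem primrecPred_exists_lt {b : α → ℕ} {P : ℕ → α → Prop} (hb : Primrec b)
    (hP : PrimrecRel P) : PrimrecPred fun a => ∃ j < b a, P j a :=
  (hP.exists_mem_list.comp (list_range.comp hb) Primrec.id).of_eq (by simp)

theorem primrecPred_forall_lt {b : α → ℕ} {P : ℕ → α → Prop} (hb : Primrec b)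
    (hP : PrimrecRel P) : PrimrecPred fun a => ∀ j < b a, P j a :=
  (hP.forall_mem_list.comp (list_range.comp hb) Primrec.id).of_eq (by simp)

theorem primrec_unpair_fst {f : α → ℕ} (hf : Primrec f) : Primrec fun a => (f a).unpair.1 :=
  fst.comp (Primrec.unpair.comp hf)

theorem primrec_unpair_snd {f : α → ℕ} (hf : Primrec f) : Primrec fun a => (f a).unpair.2 :=
  snd.comp (Primrec.unpair.comp hf)

theorem primrecPred_eq_const {f : α → ℕ} (hf : Primrec f) (n : ℕ) : PrimrecPred fun a => f a = n :=
  Primrec.eq.comp hf (const n)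

theorem primrecPred_codeLe {f g : α → ℕ} (hf : Primrec f) (hg : Primrec g) :
    PrimrecPred fun a => CodeLe (f a) (g a) := by
  have hf2 := nat_mod.comp hf (const 2)
  have hg2 := nat_mod.comp hg (const 2)
  exact ((primrecPred_eq_const hf2 0).and ((primrecPred_eq_const hg2 0).and
    (nat_le.comp hf hg))).or ((primrecPred_eq_const hf2 1).and
      ((primrecPred_eq_const hg2 0).or (nat_le.comp hg hf)))

theorem primrecPred_codeHolds {r f g : α → ℕ} (hr : Primrec r) (hf : Primrec f)
    (hg : Primrec g) : PrimrecPred fun a => CodeHolds (r a) (f a) (g a) :=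
  ((primrecPred_eq_const hr 0).and (Primrec.eq.comp hf hg)).or
    (((primrecPred_eq_const hr 1).and (Primrec.eq.comp hf hg).not).or
      (((primrecPred_eq_const hr 2).and (primrecPred_codeLe hf hg)).or
        ((primrecPred_eq_const hr 3).and (primrecPred_codeLe hg hf).not)))

theorem primrecPred_codeWellDefined {n p t : α → ℕ} (hn : Primrec n) (hp : Primrec p)
    (ht : Primrec t) : PrimrecPred fun a => CodeWellDefined (n a) (p a) (t a) :=
  (primrecPred_eq_const (primrec_unpair_fst ht) 0).or
    (nat_lt.comp (nat_add.comp hp (primrec_unpair_snd (primrec_unpair_snd ht))) hn)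

theorem primrec_codeEval {R : α → List (List ℕ)} {p t : α → ℕ} (hR : Primrec R) (hp : Primrec p)
    (ht : Primrec t) : Primrec fun a => codeEval (R a) (p a) (t a) :=
  Primrec.ite (primrecPred_eq_const (primrec_unpair_fst ht) 0) (primrec_unpair_snd ht)
    ((list_getD 0).comp ((list_getD []).comp hR
      (nat_add.comp hp (primrec_unpair_snd (primrec_unpair_snd ht))))
      (primrec_unpair_fst (primrec_unpair_snd ht)))

theorem primrecPred_codeAtom {R : α → List (List ℕ)} {p c : α → ℕ} (hR : Primrec R)
    (hp : Primrec p) (hc : Primrec c) : PrimrecPred fun a => CodeAtom (R a) (p a) (c a) := by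
  have hn := list_length.comp hR
  have hl := primrec_unpair_fst (primrec_unpair_snd hc)
  have hr := primrec_unpair_snd (primrec_unpair_snd hc)
  exact (nat_lt.comp hp hn).and
    (((primrecPred_codeWellDefined hn hp hl).and (primrecPred_codeWellDefined hn hp hr)).not.or
      (primrecPred_codeHolds (primrec_unpair_fst hc) (primrec_codeEval hR hp hl)
        (primrec_codeEval hR hp hr)))

theorem primrecPred_entry {H : α → List (List Bool)} {c p : α → ℕ} (hH : Primrec H)
    (hc : Primrec c) (hp : Primrec p) : PrimrecPred fun a => Entry (H a) (c a) (p a) :=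
  Primrec.eq.comp ((list_getD false).comp ((list_getD []).comp hH hc) hp) (const true)

theorem primrecPred_step {R : α → List (List ℕ)} {H : α → List (List Bool)} {p : α → ℕ}
    (hR : Primrec R) (hH : Primrec H) (hp : Primrec p) :
    PrimrecPred fun a => Step (R a) (H a) (p a) := by
  have ht := primrec_unpair_fst (list_length.comp hH)
  have hx := primrec_unpair_snd (list_length.comp hH)
  have hx1 := primrec_unpair_fst hx
  have hx2 := primrec_unpair_snd hx
  have hn := list_length.comp hR
  have hinner : PrimrecPred fun a : ℕ × α => ∀ l < a.1, p a.2 ≤ l →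
      Entry (H a.2) (H a.2).length.unpair.2.unpair.1 l := by
    refine primrecPred_forall_lt fst (P := fun l a => p a.2 ≤ l →
      Entry (H a.2) (H a.2).length.unpair.2.unpair.1 l) ?_
    have ha : Primrec fun b : ℕ × ℕ × α => b.2.2 := snd.comp snd
    refine (PrimrecPred.or (nat_le.comp (hp.comp ha) fst).not
      (primrecPred_entry (hH.comp ha) (hx1.comp ha) fst)).of_eq fun b => ?_
    exact imp_iff_not_or.symm
  refine ((primrecPred_eq_const ht 0).and (primrecPred_codeAtom hR hp hx)).or
    (((primrecPred_eq_const ht 1).and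
      ((primrecPred_entry hH hx1 hp).and (primrecPred_entry hH hx2 hp))).or
    (((primrecPred_eq_const ht 2).and (primrecPred_entry hH hx hp).not).or
    (((primrecPred_eq_const ht 3).and ((nat_lt.comp (succ.comp hp) hn).and
      (primrecPred_entry hH hx (succ.comp hp)))).or
    ((primrecPred_eq_const ht 4).and (primrecPred_exists_lt hn ?_)))))
  exact (nat_le.comp (hp.comp snd) fst).and
    ((primrecPred_entry (hH.comp snd) (hx2.comp snd) fst).and hinner)

theorem primrec_truthTable : Primrec₂ truthTable := by
  classical
  have h : PrimrecPred fun b : (List (List ℕ) × List (List Bool)) × ℕ => Step b.1.1 b.1.2 b.2 :=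
    primrecPred_step (fst.comp fst) (snd.comp fst) snd
  exact list_map (list_range.comp (succ.comp (list_length.comp fst))) h.decide.to₂

theorem primrec_tables {R : α → List (List ℕ)} {c : α → ℕ} (hR : Primrec R) (hc : Primrec c) :
    Primrec fun a => tables (R a) (c a) :=
  nat_rec' hc (const []) (list_concat.comp (snd.comp snd)
    (primrec_truthTable.comp (hR.comp fst) (snd.comp snd))).to₂

/-- Satisfaction of the property with code `c` by the trace with coded rows `R`. -/
def CodeSat (R : List (List ℕ)) (c : ℕ) : Prop := Entry (tables R (c + 1)) c 0

theorem codeSat_iff {k : ℕ} {R : List (List ℕ)} {σ : Trace k} (hR : σ.1 = R.map (decodeRow k))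
    (φ : Property k) : CodeSat R φ.code ↔ Sat σ φ :=
  entry_iff hR φ (Nat.lt_succ_self _) (Nat.zero_le _)

theorem primrecPred_codeSat {R : α → List (List ℕ)} {c : α → ℕ} (hR : Primrec R)
    (hc : Primrec c) : PrimrecPred fun a => CodeSat (R a) (c a) :=
  primrecPred_entry (primrec_tables hR (succ.comp hc)) hc (const 0)

/-! ### Bounded search for an extension -/

/-- A bound for the code of a list of length at most `n` whose elements have codes at most `m`. -/
def listBound (m n : ℕ) : ℕ := Nat.rec 0 (fun _ b => Nat.pair m b + 1) n

theorem pair_le_pair {a b c d : ℕ} (h₁ : a ≤ c) (h₂ : b ≤ d) : Nat.pair a b ≤ Nat.pair c d := by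
  rcases h₁.eq_or_lt with rfl | h₁
  · rcases h₂.eq_or_lt with rfl | h₂
    · exact le_rfl
    · exact (Nat.pair_lt_pair_right _ h₂).le
  · rcases h₂.eq_or_lt with rfl | h₂
    · exact (Nat.pair_lt_pair_left _ h₁).le
    · exact ((Nat.pair_lt_pair_left _ h₁).trans (Nat.pair_lt_pair_right _ h₂)).le

/-- The code of a nonempty list is one more than the pair of the codes of head and tail, and pairing
is monotone in both arguments. -/
theorem encode_le_listBound {β : Type*} [Encodable β] {m n : ℕ} (l : List β)
    (hm : ∀ a ∈ l, encode a ≤ m) (hn : l.length ≤ n) : encode l ≤ listBound m n := by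
  induction l generalizing n with
  | nil => exact Nat.zero_le _
  | cons a l ih =>
    obtain ⟨n, rfl⟩ := Nat.exists_eq_add_of_le' (show 1 ≤ n from le_trans (by simp) hn)
    rw [encode_list_cons]
    change Nat.pair (encode a) (encode l) + 1 ≤ Nat.pair m (listBound m n) + 1
    exact Nat.succ_le_succ (pair_le_pair (hm a (by simp))
      (ih (fun b hb => hm b (by simp [hb])) (by simpa using hn)))

theorem encode_le_of_mem {β : Type*} [Encodable β] {a : β} {l : List β} (h : a ∈ l) :
    encode a ≤ encode l := by
  induction l with
  | nil => simp at h
  | cons b l ih =>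
    rw [encode_list_cons]
    rcases List.mem_cons.1 h with rfl | h
    · exact (Nat.left_le_pair _ _).trans (Nat.le_succ _)
    · exact ((ih h).trans (Nat.right_le_pair _ _)).trans (Nat.le_succ _)

theorem primrec_listBound {m n : α → ℕ} (hm : Primrec m) (hn : Primrec n) :
    Primrec fun a => listBound (m a) (n a) :=
  nat_rec' hn (const 0)
    (succ.comp (Primrec₂.natPair.comp (hm.comp fst) (snd.comp snd))).to₂

/-- A bound for the codes of extensions. -/
def searchBound (N : ℕ) : ℕ :=
  listBound (listBound (2 * (lengthBound N * N + (2 * N + 1))) N) (lengthBound N)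

theorem primrec_pow {f g : α → ℕ} (hf : Primrec f) (hg : Primrec g) :
    Primrec fun a => f a ^ g a :=
  (nat_rec' hg (const 1) (nat_mul.comp (snd.comp snd) (hf.comp fst)).to₂).of_eq fun a => by
    induction g a with
    | zero => rfl
    | succ n ih => rw [pow_succ, ← ih]

theorem primrec_lengthBound : Primrec lengthBound := by
  have h1 : Primrec fun N : ℕ => N + 1 := succ
  have h2 : Primrec fun N : ℕ => 2 * N + 1 := nat_double_succ
  have h3 := nat_add.comp (nat_mul.comp Primrec.id h1) h2
  have h4 : Primrec typeBound :=
    nat_mul.comp (primrec_pow (const 2) h1) (primrec_pow (const 2) (primrec_pow h3 (const 2)))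
  exact nat_add.comp (nat_add.comp Primrec.id h4) h1

theorem primrec_searchBound : Primrec searchBound :=
  primrec_listBound (primrec_listBound (nat_mul.comp (const 2) (nat_add.comp
    (nat_mul.comp primrec_lengthBound Primrec.id) nat_double_succ)) Primrec.id) primrec_lengthBound

/-- A bounded search for a satisfying extension. -/
def CodeExtends (R : List (List ℕ)) (c : ℕ) : Prop :=
  ∃ n < searchBound (c + encode R) + 1, ∃ e : List (List ℕ),
    (decode n : Option (List (List ℕ))).getD [] = e ∧ e ≠ [] ∧ CodeSat (R ++ e) c

theorem primrecPred_codeExtends {R : α → List (List ℕ)} {c : α → ℕ} (hR : Primrec R)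
    (hc : Primrec c) : PrimrecPred fun a => CodeExtends (R a) (c a) := by
  have he : Primrec fun b : ℕ × α => (decode b.1 : Option (List (List ℕ))).getD [] :=
    option_getD.comp (Primrec.decode.comp fst) (const [])
  refine primrecPred_exists_lt (succ.comp (primrec_searchBound.comp
    (nat_add.comp hc (Primrec.encode.comp hR)))) ?_
  refine ((Primrec.eq.comp he (const [])).not.and (primrecPred_codeSat
    (list_append.comp (hR.comp snd) he) (hc.comp snd))).of_eq fun b => ?_
  simp

end Primrec

/-! ### Correctness of the bounded search -/

theorem intEquivNat_le (x : ℤ) (m : ℕ) (h : |x| ≤ m) : Equiv.intEquivNat x ≤ 2 * m := by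
  have h := abs_le.1 h
  cases x with
  | ofNat n =>
    have := intEquivNat_natCast n
    simp only [Int.ofNat_eq_natCast] at h ⊢
    omega
  | negSucc n =>
    rw [intEquivNat_negSucc]
    omega

/-- The codes of the values of an assignment. -/
def encodeRow {k : ℕ} (w : Assignment k) : List ℕ := (List.ofFn w).map encode

theorem getD_encodeRow {k : ℕ} (w : Assignment k) (v : Fin k) :
    (encodeRow w).getD v 0 = Equiv.intEquivNat (w v) := by
  simp only [encodeRow, List.getD_eq_getElem?_getD, List.getElem?_map, List.getElem?_ofFn, v.2,
    dif_pos, Option.map_some, Option.getD_some]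
  rfl

theorem decodeRow_encodeRow {k : ℕ} (w : Assignment k) : decodeRow k (encodeRow w) = w := by
  funext v
  rw [decodeRow, getD_encodeRow, Equiv.symm_apply_apply]

theorem map_decodeRow_map_encodeRow {k : ℕ} (l : List (Assignment k)) :
    l = (l.map encodeRow).map (decodeRow k) := by
  simp [Function.comp_def, decodeRow_encodeRow]

theorem codeExtends_iff {k : ℕ} (τ : Trace k) (φ : Property k) :
    CodeExtends (τ.1.map encodeRow) φ.code ↔ ∃ τ' : Trace k, Sat (τ.append τ') φ := by
  have hτ := map_decodeRow_map_encodeRow τ.1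
  set R := τ.1.map encodeRow with hR
  constructor
  · rintro ⟨-, -, e, -, he, hsat⟩
    -- Rows of any length are admissible in the search: decoding pads with `0` or truncates to `k`
    -- values.
    refine ⟨⟨e.map (decodeRow k), by simpa using he⟩, (codeSat_iff ?_ φ).1 hsat⟩
    rw [List.map_append, ← hτ]
    rfl
  · rintro ⟨τ', hsat⟩
    set N := φ.code + encode R with hN
    have hlenR : τ.length ≤ encode R := by
      have := Encodable.length_le_encode R
      rwa [hR, List.length_map] at this
    have hrow : ∀ w ∈ τ.1, encode (encodeRow w) ≤ N := fun w hw =>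
      (encode_le_of_mem (List.mem_map_of_mem hw)).trans (Nat.le_add_left _ _)
    -- The number of variables is not an input; since the trace is nonempty, it is bounded through
    -- the length of one of its rows.
    have hk : k ≤ N := by
      obtain ⟨w, hw⟩ := List.exists_mem_of_ne_nil _ τ.2
      have h1 := Encodable.length_le_encode (encodeRow w)
      simp only [encodeRow, List.length_map, List.length_ofFn] at h1
      exact h1.trans (hrow w hw)
    have hlen : (τ.append τ').length = τ.length + τ'.length := List.length_append
    have hpos : 0 < τ'.length := List.length_pos_of_ne_nil τ'.2
    have hpre : ∀ q < τ.length, (τ.append τ').1.getD q 0 = τ.1.getD q 0 := fun q hq =>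
      List.getD_append _ _ _ _ hq
    obtain ⟨σ, h1, h2, h3, h4, h5⟩ := exists_small (m := τ.length) hk
      (hlenR.trans (Nat.le_add_left _ _)) (τ.append τ') (by omega) (fun q hq v => by
        rw [hpre q hq, List.getD_eq_getElem _ _ hq]
        have h1 := hrow _ (List.getElem_mem hq)
        have h2 : Equiv.intEquivNat (τ.1[q] v) ≤ encode (encodeRow τ.1[q]) :=
          encode_le_of_mem (List.mem_map_of_mem (f := (encode : ℤ → ℕ))
            ((List.mem_ofFn' τ.1[q] _).2 ⟨v, rfl⟩))
        have h3 := abs_le.1 (abs_le_intEquivNat (τ.1[q] v))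
        exact ⟨by omega, by omega⟩)
    have hσ : σ.1 = τ.1 ++ σ.1.drop τ.length := by
      conv_lhs => rw [← List.take_append_drop τ.length σ.1]
      congr 1
      refine List.ext_getElem ?_ fun q hq hq' => ?_
      · rw [List.length_take]
        exact min_eq_left h1.le
      · have hqσ : q < σ.1.length := lt_trans hq' h1
        have := (h4 q hq').trans (hpre q hq')
        rw [List.getD_eq_getElem _ _ hqσ, List.getD_eq_getElem _ _ hq'] at this
        rw [List.getElem_take, this]
    set e := (σ.1.drop τ.length).map encodeRow with he
    have hcode : encode e ≤ searchBound N := by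
      refine encode_le_listBound e (fun row hrow => ?_) ?_
      · obtain ⟨w, hw, rfl⟩ := List.mem_map.1 hrow
        obtain ⟨q, hq, rfl⟩ := List.mem_iff_getElem.1 (List.mem_of_mem_drop hw)
        refine encode_le_listBound _ (fun a ha => ?_) (by simpa [encodeRow] using hk)
        obtain ⟨x, hx, rfl⟩ := List.mem_map.1 ha
        obtain ⟨v, rfl⟩ := (List.mem_ofFn' _ _).1 hx
        have := h3 q hq v
        rw [List.getD_eq_getElem _ _ hq] at this
        exact intEquivNat_le _ _ (by exact_mod_cast this)
      · rw [he, List.length_map, List.length_drop]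
        exact (Nat.sub_le _ _).trans h2
    refine ⟨encode e, Nat.lt_succ_of_le hcode, e, by rw [encodek, Option.getD_some], ?_, ?_⟩
    · rw [he, Ne, List.map_eq_nil_iff, List.drop_eq_nil_iff, not_le]
      exact h1
    · refine (codeSat_iff (σ := σ) ?_ φ).2 ((h5 φ (Nat.le_add_right _ _)).2 hsat)
      rw [List.map_append, ← hτ, he, ← map_decodeRow_map_encodeRow]
      exact hσ

/-! ### The monitor -/

open Classical in
/-- The monitor. -/
noncomputable def monitor (x : ℕ × List (List ℤ)) : RV :=
  if CodeSat (x.2.map (List.map encode)) x.1 then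
    if CodeExtends (x.2.map (List.map encode)) (Nat.pair 2 x.1) then .cs else .ps
  else
    if CodeExtends (x.2.map (List.map encode)) x.1 then .cv else .pv

open Primrec in
theorem primrec_monitor : Primrec monitor := by
  classical
  have hR : Primrec fun x : ℕ × List (List ℤ) => x.2.map (List.map encode) :=
    list_map snd (list_map snd (Primrec.encode.comp snd).to₂).to₂
  have h : Primrec fun x : ℕ × List (List ℤ) => Nat.pair 2 x.1 :=
    Primrec₂.natPair.comp (const 2) fst
  exact Primrec.ite (primrecPred_codeSat hR fst)
    (Primrec.ite (primrecPred_codeExtends hR h) (const _) (const _))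
    (Primrec.ite (primrecPred_codeExtends hR fst) (const _) (const _))

theorem inState_unique {k : ℕ} {τ : Trace k} {ψ : Property k} {s s' : RV}
    (h : InState τ ψ s) (h' : InState τ ψ s') : s = s' := by
  cases s <;> cases s' <;> first | rfl | (simp only [InState] at h h'; grind)

theorem inState_monitor {k : ℕ} (ψ : Property k) (τ : Trace k) :
    InState τ ψ (monitor (ψ.code, τ.rows)) := by
  have hR : τ.rows.map (List.map encode) = τ.1.map encodeRow := by
    simp only [Trace.rows, List.map_map]
    rfl
  have hsat : CodeSat (τ.rows.map (List.map encode)) ψ.code ↔ Sat τ ψ := by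
    rw [hR]
    exact codeSat_iff (map_decodeRow_map_encodeRow τ.1) ψ
  have hext : CodeExtends (τ.rows.map (List.map encode)) ψ.code ↔
      ∃ τ' : Trace k, Sat (τ.append τ') ψ := by
    rw [hR]
    exact codeExtends_iff τ ψ
  -- Tag `2` codes negation, so this search looks for a violating extension.
  have hext' : CodeExtends (τ.rows.map (List.map encode)) (Nat.pair 2 ψ.code) ↔
      ∃ τ' : Trace k, ¬ Sat (τ.append τ') ψ := by
    rw [hR]
    exact codeExtends_iff τ ψ.not
  unfold monitor
  split_ifs with h1 h2 h2
  · exact ⟨hsat.1 h1, hext'.1 h2⟩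
  · exact ⟨hsat.1 h1, fun τ' => by_contra fun h => h2 (hext'.2 ⟨τ', h⟩)⟩
  · exact ⟨mt hsat.2 h1, hext.1 h2⟩
  · exact ⟨mt hsat.2 h1, fun τ' h => h2 (hext.2 ⟨τ', h⟩)⟩

end ALTLf

/-- There is one algorithm that, given a property `ψ` whose atoms are monotonicity constraints over
`ℤ` and a trace `τ`, computes the monitoring state of `ψ` after `τ`. -/
theorem mainTheorem8 :
    ∃ monitor : ℕ × List (List ℤ) → ALTLf.RV, Computable monitor ∧
      ∀ k : ℕ, 0 < k → ∀ (ψ : ALTLf.Property k) (τ : ALTLf.Trace k) (s : ALTLf.RV),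
        monitor (ψ.code, τ.rows) = s ↔ ALTLf.InState τ ψ s := by
  refine ⟨ALTLf.monitor, ALTLf.primrec_monitor.to_comp, fun k _ ψ τ s => ⟨?_, fun h => ?_⟩⟩
  · rintro rfl
    exact ALTLf.inState_monitor ψ τ
  · exact ALTLf.inState_unique (ALTLf.inState_monitor ψ τ) h
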